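/- All spaces are topological spaces and all maps are continuous. Let $A\xrightarrow{p}X\xleftarrow{\varphi}K$ be maps, where $K$ is a normal space, and let $n\ge 0$ be an integer. Call $Z\subset K$ \emph{$\varphi$-sectional} if there is a map $s:Z\to A$ with $p\circ s\simeq\varphi|_Z$. The \emph{relative sectional category} $\mathrm{secat}_\varphi(p)\in\{0,1,2,\dots,\infty\}$ is the least $m$ such that $K$ is the union of $m+1$ open $\varphi$-sectional subsets ($\infty$ if there is no such $m$). For maps $f:Y\to C$ and $g:Z\to C$, put $E_{f,g}=\{(y,z,\theta)\in Y\times Z\times C^{[0,1]} : \theta(0)=f(y),\ \theta(1)=g(z)\}$ (standard homotopy pullback; $C^{[0,1]}$ has the compact-open topology). The \emph{join} of $f$ and $g$ is the double mapping cylinder $Y*_CZ=(Y\sqcup Z\sqcup E_{f,g}\times[0,1])/\!\sim$ with the quotient topology, where $((y,z,\theta),0)\sim y$ and $((y,z,\theta),1)\sim z$, together with the map $Y*_CZ\to C$ that is $f$ on $Y$, $g$ on $Z$ and sends the class of $((y,z,\theta),t)$ to $\theta(t)$. Let $j^0_p=p:A\to X$, and for $n\ge1$ let $j^n_p:*^n_XA\to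 X$ be the join of $j^{n-1}_p$ and $p$. Let $\kappa_0=p:T^0(p)=A\to X$, and for $n\ge1$ let $\kappa_n:T^n(p)\to X^{n+1}=X^n\times X$ be the join of $\kappa_{n-1}\times\mathrm{id}_X$ and $\mathrm{id}_{X^n}\times p$. Let $\Delta_{n+1}:X\to X^{n+1}$ be the diagonal map. Then the following statements are equivalent: 1. $\mathrm{secat}_\varphi(p)\le n$. 2. There is a map $\sigma:K\to *^n_XA$ such that $j^n_p\circ\sigma\simeq\varphi$. 3. There is a map $\sigma:K\to T^n(p)$ such that $\kappa_n\circ\sigma\simeq\Delta_{n+1}\circ\varphi$. -/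

import Mathlib

universe u v

noncomputable section

namespace RelSecat

/-- The standard homotopy pullback `E_{f,g} = {(a, b, θ) ∈ A × B × C^[0,1] | θ 0 = f a, θ 1 = g b}`
of `f : A → C` and `g : B → C`; the path space `C^[0,1]` carries the compact-open topology. -/
def HPullback {A B C : Type*} [TopologicalSpace A] [TopologicalSpace B] [TopologicalSpace C]
    (f : C(A, C)) (g : C(B, C)) : Type _ :=
  {x : A × B × C(unitInterval, C) // x.2.2 0 = f x.1 ∧ x.2.2 1 = g x.2.1}

namespace HPullback

variable {A B C : Type*} [TopologicalSpace A] [TopologicalSpace B] [TopologicalSpace C]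

instance (f : C(A, C)) (g : C(B, C)) : TopologicalSpace (HPullback f g) :=
  inferInstanceAs (TopologicalSpace {x : A × B × C(unitInterval, C) // x.2.2 0 = f x.1 ∧ x.2.2 1 = g x.2.1})

/-- The projection `E_{f,g} → A`. -/
def fst (f : C(A, C)) (g : C(B, C)) : C(HPullback f g, A) where
  toFun x := x.1.1
  continuous_toFun := continuous_fst.comp continuous_subtype_val

/-- The projection `E_{f,g} → B`. -/
def snd (f : C(A, C)) (g : C(B, C)) : C(HPullback f g, B) where
  toFun x := x.1.2.1
  continuous_toFun := (continuous_fst.comp continuous_snd).comp continuous_subtype_val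

/-- The canonical homotopy `((a, b, θ), t) ↦ θ t` from `f ∘ fst` to `g ∘ snd`. -/
def homotopy (f : C(A, C)) (g : C(B, C)) :
    ContinuousMap.Homotopy (f.comp (fst f g)) (g.comp (snd f g)) where
  toFun y := y.2.1.2.2 y.1
  continuous_toFun := by
    have h : Continuous fun y : unitInterval × HPullback f g => (y.2.1.2.2 : C(unitInterval, C)) :=
      ((continuous_snd.comp continuous_snd).comp continuous_subtype_val).comp continuous_snd
    exact h.eval continuous_fst
  map_zero_left x := x.2.1
  map_one_left x := x.2.2

end HPullback

/-- The gluing relation of the double mapping cylinder of `α : P → A` and `β : P → B`: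
`(x, 0) ∼ α x` and `(x, 1) ∼ β x`. -/
inductive HPushoutRel {P A B : Type*} [TopologicalSpace P] [TopologicalSpace A]
    [TopologicalSpace B] (α : C(P, A)) (β : C(P, B)) :
    (A ⊕ B) ⊕ (P × unitInterval) → (A ⊕ B) ⊕ (P × unitInterval) → Prop
  | left (x : P) : HPushoutRel α β (Sum.inr (x, 0)) (Sum.inl (Sum.inl (α x)))
  | right (x : P) : HPushoutRel α β (Sum.inr (x, 1)) (Sum.inl (Sum.inr (β x)))

/-- The standard homotopy pushout of `α : P → A` and `β : P → B`, that is, the double mapping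
cylinder `(A ⊔ B ⊔ P × [0,1]) / ∼` with the quotient topology. -/
def HPushout {P A B : Type*} [TopologicalSpace P] [TopologicalSpace A]
    [TopologicalSpace B] (α : C(P, A)) (β : C(P, B)) : Type _ :=
  Quot (HPushoutRel α β)

namespace HPushout

variable {P A B C : Type*} [TopologicalSpace P] [TopologicalSpace A] [TopologicalSpace B]
  [TopologicalSpace C]

instance (α : C(P, A)) (β : C(P, B)) : TopologicalSpace (HPushout α β) :=
  inferInstanceAs (TopologicalSpace (Quot (HPushoutRel α β)))

/-- The co-whisker map induced by `f : A → C`, `g : B → C` and a homotopy `H` from `f ∘ α` to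
`g ∘ β`: it is `f` on `A`, `g` on `B`, and sends the class of `(x, t)` to `H (t, x)`. -/
def coWhisker {α : C(P, A)} {β : C(P, B)} {f : C(A, C)} {g : C(B, C)}
    (H : ContinuousMap.Homotopy (f.comp α) (g.comp β)) : C(HPushout α β, C) where
  toFun := Quot.lift (Sum.elim (Sum.elim f g) fun y => H (y.2, y.1)) (by
    rintro _ _ (x | x) <;> simp)
  continuous_toFun := by
    refine continuous_quot_lift _ ?_
    exact (f.continuous.sumElim g.continuous).sumElim
      (H.continuous.comp (continuous_snd.prodMk continuous_fst))

end HPushout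

/-- The join `A *_C B` of `f : A → C` and `g : B → C`: the homotopy pushout of the two projections
of the homotopy pullback of `f` and `g`. -/
abbrev Join {A B C : Type*} [TopologicalSpace A] [TopologicalSpace B] [TopologicalSpace C]
    (f : C(A, C)) (g : C(B, C)) : Type _ :=
  HPushout (HPullback.fst f g) (HPullback.snd f g)

/-- The join map `A *_C B → C` (the canonical co-whisker map). -/
def joinMap {A B C : Type*} [TopologicalSpace A] [TopologicalSpace B] [TopologicalSpace C]
    (f : C(A, C)) (g : C(B, C)) : C(Join f g, C) :=
  HPushout.coWhisker (HPullback.homotopy f g)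

/-- A topological space together with a continuous map to `X`. -/
structure SpaceOver (X : Type u) [TopologicalSpace X] where
  carrier : Type u
  [top : TopologicalSpace carrier]
  map : C(carrier, X)

attribute [instance] SpaceOver.top

variable {A X : Type u} [TopologicalSpace A] [TopologicalSpace X]

/-- The iterated join: `j^0_p = p`, and `j^{n+1}_p` is the join of `j^n_p` and `p`. -/
def iterJoin (p : C(A, X)) : ℕ → SpaceOver X
  | 0 => ⟨A, p⟩
  | n + 1 => ⟨Join (iterJoin p n).map p, joinMap (iterJoin p n).map p⟩

/-- The total space `*^n_X A` of the iterated join. -/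
abbrev IterJoin (p : C(A, X)) (n : ℕ) : Type u := (iterJoin p n).carrier

/-- The iterated join map `j^n_p : *^n_X A → X`. -/
abbrev iterJoinMap (p : C(A, X)) (n : ℕ) : C(IterJoin p n, X) := (iterJoin p n).map

/-- The `n`-fold diagonal `Δ_n : X → X^n`. -/
def diag (X : Type*) [TopologicalSpace X] (n : ℕ) : C(X, Fin n → X) where
  toFun x := fun _ => x

/-- The canonical identification `X^n × X → X^{n+1}`. -/
def snocMap (X : Type*) [TopologicalSpace X] (n : ℕ) : C((Fin n → X) × X, Fin (n + 1) → X) where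
  toFun y := Fin.snoc (α := fun _ => X) y.1 y.2
  continuous_toFun := Continuous.finSnoc (A := fun _ => X) continuous_fst continuous_snd

/-- The sectional fat wedge `κ_n : T^n(p) → X^{n+1}`: `κ_0 = p` (with `X^1 = X`), and `κ_{n+1}` is
the join of `κ_n × id` and `id × p`, both of which are maps into `X^{n+1} × X = X^{n+2}`. -/
def fatWedge (p : C(A, X)) : (n : ℕ) → SpaceOver (Fin (n + 1) → X)
  | 0 => ⟨A, (diag X 1).comp p⟩
  | n + 1 =>
    ⟨Join ((fatWedge p n).map.prodMap (ContinuousMap.id X))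
        ((ContinuousMap.id (Fin (n + 1) → X)).prodMap p),
      (snocMap X (n + 1)).comp
        (joinMap ((fatWedge p n).map.prodMap (ContinuousMap.id X))
          ((ContinuousMap.id (Fin (n + 1) → X)).prodMap p))⟩

/-- The total space `T^n(p)` of the sectional fat wedge. -/
abbrev FatWedge (p : C(A, X)) (n : ℕ) : Type u := (fatWedge p n).carrier

/-- The map `κ_n : T^n(p) → X^{n+1}`. -/
abbrev fatWedgeMap (p : C(A, X)) (n : ℕ) : C(FatWedge p n, Fin (n + 1) → X) :=
  (fatWedge p n).map

/-- A subset `Z` of `K` is `φ`-sectional (with respect to `p`) if there is a map `s : Z → A` with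
`p ∘ s ≃ φ|_Z`. -/
def IsSectional {A X K : Type*} [TopologicalSpace A] [TopologicalSpace X] [TopologicalSpace K]
    (φ : C(K, X)) (p : C(A, X)) (Z : Set K) : Prop :=
  ∃ s : C(Z, A), (p.comp s).Homotopic (φ.restrict Z)

/-- The sectional category of `p` relative to `φ`: the least `n` such that `K` is covered by
`n + 1` open `φ`-sectional subsets, and `∞` if there is no such `n`. -/
def relSecat {A X K : Type*} [TopologicalSpace A] [TopologicalSpace X] [TopologicalSpace K]
    (φ : C(K, X)) (p : C(A, X)) : ℕ∞ :=
  sInf {m : ℕ∞ | ∃ n : ℕ, m = n ∧ ∃ U : Fin (n + 1) → Set K,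
    (∀ i, IsOpen (U i)) ∧ (∀ i, IsSectional φ p (U i)) ∧ ⋃ i, U i = Set.univ}

end RelSecat

end

namespace RelSecat

open Set Topology unitInterval

/-! Everything rests on one statement about two maps `f : Y → C` and `g : Z → C`: for normal `K`, a
map `ψ : K → C` lifts up to homotopy through the join of `f` and `g` iff `K` is a union of two open
sets on which `ψ` lifts through `f` and `g` respectively. A lift gives the cover by pulling back the
two overlapping ends of the double mapping cylinder, each of which slides onto its end along the
paths (`HasHomotopyLift.exists_open_cover_of_join`). Conversely, a Urysohn function supplies the
cylinder coordinate, and the two homotopies concatenated on the overlap supply a point of `E_{f,g}`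
(`hasHomotopyLift_join_of_open_cover`).

The theorem follows by induction on `n`, splitting off the last member of a cover. The union of the
other members need not be normal, so it is first shrunk to a closed set
(`HasSectionalCover.exists_closed`); for this reason `K` varies in the induction.

For the fat wedge the induction runs over arbitrary families `ψ i`, one for each coordinate. A
factor `id` in a product map imposes no lifting condition, so the same join criterion applies; the
diagonal is the case of a constant family. -/

/-- `ψ : K → C` lifts through `f : Y → C` up to homotopy. -/
def HasHomotopyLift {K Y C : Type*} [TopologicalSpace K] [TopologicalSpace Y] [TopologicalSpace C]
    (f : C(Y, C)) (ψ : C(K, C)) : Prop :=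
  ∃ s : C(K, Y), (f.comp s).Homotopic ψ

/-! ### Homotopy lifts and sectional subsets -/

section HomotopyLift

variable {K L Y C D : Type*} [TopologicalSpace K] [TopologicalSpace L] [TopologicalSpace Y]
  [TopologicalSpace C] [TopologicalSpace D]

theorem homotopic_iff_exists_pathFamily {f g : C(K, C)} :
    f.Homotopic g ↔ ∃ Γ : C(K, C(I, C)), ∀ x, Γ x 0 = f x ∧ Γ x 1 = g x := by
  constructor
  · rintro ⟨H⟩
    refine ⟨ContinuousMap.curry (H.toContinuousMap.comp ContinuousMap.prodSwap), fun x => ?_⟩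
    exact ⟨H.map_zero_left x, H.map_one_left x⟩
  · rintro ⟨Γ, hΓ⟩
    exact ⟨⟨⟨fun y => Γ y.2 y.1, (Γ.continuous.comp continuous_snd).eval continuous_fst⟩,
      fun x => (hΓ x).1, fun x => (hΓ x).2⟩⟩

/-- Packaging a lift and its homotopy as one map into `Y × C(I, C)` lets both be glued, or descended
along a quotient map, in a single step. -/
theorem hasHomotopyLift_iff {f : C(Y, C)} {ψ : C(K, C)} :
    HasHomotopyLift f ψ ↔
      ∃ Γ : C(K, Y × C(I, C)), ∀ x, (Γ x).2 0 = f (Γ x).1 ∧ (Γ x).2 1 = ψ x := by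
  constructor
  · rintro ⟨s, hs⟩
    obtain ⟨Γ, hΓ⟩ := homotopic_iff_exists_pathFamily.1 hs
    exact ⟨s.prodMk Γ, hΓ⟩
  · rintro ⟨Γ, hΓ⟩
    exact ⟨ContinuousMap.fst.comp Γ,
      homotopic_iff_exists_pathFamily.2 ⟨ContinuousMap.snd.comp Γ, hΓ⟩⟩

theorem HasHomotopyLift.comp {f : C(Y, C)} {ψ : C(K, C)} (h : HasHomotopyLift f ψ) (k : C(L, K)) :
    HasHomotopyLift f (ψ.comp k) := by
  obtain ⟨s, hs⟩ := h
  exact ⟨s.comp k, hs.comp (ContinuousMap.Homotopic.refl k)⟩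

theorem HasHomotopyLift.of_homotopic {f : C(Y, C)} {ψ ψ' : C(K, C)} (h : HasHomotopyLift f ψ)
    (hψ : ψ.Homotopic ψ') : HasHomotopyLift f ψ' := by
  obtain ⟨s, hs⟩ := h
  exact ⟨s, hs.trans hψ⟩

theorem HasHomotopyLift.postcomp {f : C(Y, C)} {ψ : C(K, C)} (h : HasHomotopyLift f ψ)
    (e : C(C, D)) : HasHomotopyLift (e.comp f) (e.comp ψ) := by
  obtain ⟨s, hs⟩ := h
  exact ⟨s, (ContinuousMap.Homotopic.refl e).comp hs⟩

/-- The coordinate over `D` is lifted by `χ` itself, so only the coordinate over `C` carries a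
condition. -/
theorem hasHomotopyLift_prodMap_id_right {f : C(Y, C)} {ψ : C(K, C)} {χ : C(K, D)} :
    HasHomotopyLift (f.prodMap (ContinuousMap.id D)) (ψ.prodMk χ) ↔ HasHomotopyLift f ψ := by
  constructor
  · rintro ⟨s, hs⟩
    exact ⟨ContinuousMap.fst.comp s, (ContinuousMap.Homotopic.refl ContinuousMap.fst).comp hs⟩
  · rintro ⟨s, hs⟩
    exact ⟨s.prodMk χ, hs.prodMk (ContinuousMap.Homotopic.refl χ)⟩

theorem hasHomotopyLift_prodMap_id_left {f : C(Y, C)} {ψ : C(K, C)} {χ : C(K, D)} :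
    HasHomotopyLift ((ContinuousMap.id D).prodMap f) (χ.prodMk ψ) ↔ HasHomotopyLift f ψ := by
  constructor
  · rintro ⟨s, hs⟩
    exact ⟨ContinuousMap.snd.comp s, (ContinuousMap.Homotopic.refl ContinuousMap.snd).comp hs⟩
  · rintro ⟨s, hs⟩
    exact ⟨χ.prodMk s, (ContinuousMap.Homotopic.refl χ).prodMk hs⟩

theorem isSectional_prodMap_id_right {f : C(Y, C)} {ψ : C(K, C)} {χ : C(K, D)} {W : Set K} :
    IsSectional (ψ.prodMk χ) (f.prodMap (ContinuousMap.id D)) W ↔ IsSectional ψ f W :=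
  hasHomotopyLift_prodMap_id_right (ψ := ψ.restrict W) (χ := χ.restrict W)

theorem isSectional_prodMap_id_left {f : C(Y, C)} {ψ : C(K, C)} {χ : C(K, D)} {W : Set K} :
    IsSectional (χ.prodMk ψ) ((ContinuousMap.id D).prodMap f) W ↔ IsSectional ψ f W :=
  hasHomotopyLift_prodMap_id_left (ψ := ψ.restrict W) (χ := χ.restrict W)

theorem isSectional_univ_iff {p : C(Y, C)} {ψ : C(K, C)} :
    IsSectional ψ p univ ↔ HasHomotopyLift p ψ :=
  ⟨fun h => HasHomotopyLift.comp (ψ := ψ.restrict univ) h ⟨fun x => ⟨x, mem_univ x⟩, by fun_prop⟩,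
    fun h => h.comp ⟨Subtype.val, continuous_subtype_val⟩⟩

theorem IsSectional.preimage {p : C(Y, C)} {ψ : C(K, C)} {W : Set K} (h : IsSectional ψ p W)
    (k : C(L, K)) : IsSectional (ψ.comp k) p (k ⁻¹' W) :=
  HasHomotopyLift.comp (ψ := ψ.restrict W) h
    ⟨fun x : k ⁻¹' W => ⟨k x, x.2⟩, by fun_prop⟩

theorem IsSectional.mono {p : C(Y, C)} {ψ : C(K, C)} {Z W : Set K} (h : IsSectional ψ p W)
    (hZ : Z ⊆ W) : IsSectional ψ p Z :=
  HasHomotopyLift.comp (ψ := ψ.restrict W) h ⟨inclusion hZ, continuous_inclusion hZ⟩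

theorem IsSectional.image_val {p : C(Y, C)} {ψ : C(K, C)} {Z : Set K} {W : Set Z}
    (h : IsSectional (ψ.restrict Z) p W) : IsSectional ψ p (Subtype.val '' W) := by
  have hZ : ∀ x : (Subtype.val '' W : Set K), (x : K) ∈ Z := by
    rintro ⟨_, x, -, rfl⟩
    exact x.2
  have hW : ∀ x : (Subtype.val '' W : Set K), (⟨x, hZ x⟩ : Z) ∈ W := by
    rintro ⟨_, x, hx, rfl⟩
    exact hx
  exact HasHomotopyLift.comp (ψ := (ψ.restrict Z).restrict W) h
    ⟨fun x : (Subtype.val '' W : Set K) => ⟨⟨x, hZ x⟩, hW x⟩, by fun_prop⟩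

theorem IsSectional.of_homotopic {p : C(Y, C)} {ψ ψ' : C(K, C)} {W : Set K}
    (h : IsSectional ψ p W) (hψ : ψ.Homotopic ψ') : IsSectional ψ' p W :=
  HasHomotopyLift.of_homotopic (ψ := ψ.restrict W) h
    (hψ.comp (ContinuousMap.Homotopic.refl ⟨Subtype.val, continuous_subtype_val⟩))

end HomotopyLift

/-! ### Joins -/

namespace HPushout

variable {P A B C D : Type*} [TopologicalSpace P] [TopologicalSpace A] [TopologicalSpace B]
  [TopologicalSpace C] [TopologicalSpace D] (α : C(P, A)) (β : C(P, B))

/-- The inclusion of the left end of the double mapping cylinder. -/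
def inl : C(A, HPushout α β) where
  toFun a := Quot.mk _ (Sum.inl (Sum.inl a))
  continuous_toFun := continuous_quot_mk.comp (continuous_inl.comp continuous_inl)

/-- The inclusion of the right end of the double mapping cylinder. -/
def inr : C(B, HPushout α β) where
  toFun b := Quot.mk _ (Sum.inl (Sum.inr b))
  continuous_toFun := continuous_quot_mk.comp (continuous_inl.comp continuous_inr)

/-- The map from the cylinder to the double mapping cylinder. -/
def cyl : C(P × I, HPushout α β) where
  toFun y := Quot.mk _ (Sum.inr y)
  continuous_toFun := continuous_quot_mk.comp continuous_inr

variable {α β}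

theorem cyl_zero (x : P) : cyl α β (x, 0) = inl α β (α x) := Quot.sound (.left x)

theorem cyl_one (x : P) : cyl α β (x, 1) = inr α β (β x) := Quot.sound (.right x)

theorem ind {motive : HPushout α β → Prop} (left : ∀ a, motive (inl α β a))
    (right : ∀ b, motive (inr α β b)) (cyl : ∀ y, motive (cyl α β y)) (z : HPushout α β) :
    motive z := by
  obtain ⟨(a | b) | y⟩ := z
  exacts [left a, right b, cyl y]

theorem isOpen_iff {s : Set (HPushout α β)} :
    IsOpen s ↔ IsOpen (inl α β ⁻¹' s) ∧ IsOpen (inr α β ⁻¹' s) ∧ IsOpen (cyl α β ⁻¹' s) := by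
  refine (isQuotientMap_quot_mk (r := HPushoutRel α β)).isOpen_preimage.symm.trans ?_
  rw [isOpen_sum_iff, isOpen_sum_iff, and_assoc]
  rfl

/-- The height function of the double mapping cylinder. -/
def height (α : C(P, A)) (β : C(P, B)) : C(HPushout α β, I) where
  toFun := Quot.lift (Sum.elim (Sum.elim (fun _ => 0) fun _ => 1) Prod.snd) (by
    rintro _ _ (x | x) <;> rfl)
  continuous_toFun := continuous_quot_lift _
    ((continuous_const.sumElim continuous_const).sumElim continuous_snd)

@[simp] theorem height_inl (a : A) : height α β (inl α β a) = 0 := rfl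
@[simp] theorem height_inr (b : B) : height α β (inr α β b) = 1 := rfl
@[simp] theorem height_cyl (y : P × I) : height α β (cyl α β y) = y.2 := rfl

/-- The part of the double mapping cylinder below the right end, as the image of `A` and the
half-open cylinder. -/
def lowerChart (α : C(P, A)) (β : C(P, B)) :
    A ⊕ {y : P × I // y.2 < 1} → {z : HPushout α β | height α β z < 1} :=
  Sum.elim (fun a => ⟨inl α β a, show (0 : I) < 1 from zero_lt_one⟩)
    fun y => ⟨cyl α β y, y.2⟩

/-- The right end has height `1` and does not meet this part, and the half-open cylinder is open in
`P × I`. Hence a set with open preimage in the chart has open image in the whole double mapping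
cylinder. -/
theorem isQuotientMap_lowerChart : IsQuotientMap (lowerChart α β) := by
  have hopen : IsOpen {z : HPushout α β | height α β z < 1} :=
    isOpen_lt (height α β).continuous continuous_const
  refine ⟨⟨?_⟩, ?_⟩
  rotate_left
  · rintro ⟨z, hz⟩
    induction z using ind with
    | left a => exact ⟨Sum.inl a, rfl⟩
    | right b => exact absurd (show (1 : I) < 1 from hz) (lt_irrefl _)
    | cyl y => exact ⟨Sum.inr ⟨y, hz⟩, rfl⟩
  · have hc : Continuous (lowerChart α β) := by
      refine Continuous.sumElim ?_ ?_
      · exact (inl α β).continuous.subtype_mk _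
      · exact ((cyl α β).continuous.comp continuous_subtype_val).subtype_mk _
    ext s
    rw [isOpen_coinduced]
    refine ⟨fun h => h.preimage hc, fun h => ?_⟩
    rw [isOpen_sum_iff] at h
    have : IsOpen (Subtype.val '' s) := by
      rw [isOpen_iff]
      refine ⟨?_, ?_, ?_⟩
      · convert h.1 using 1
        ext a
        simp [lowerChart]
      · convert isOpen_empty using 1
        ext b
        simp
      · have hlt : IsOpen {y : P × I | y.2 < 1} := isOpen_lt continuous_snd continuous_const
        convert hlt.isOpenMap_subtype_val _ h.2 using 1
        ext y
        simp [lowerChart]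
    convert this.preimage continuous_subtype_val using 1
    rw [preimage_image_eq _ Subtype.val_injective]

open Classical in
-- Below height `1` the only gluing is the one at `t = 0`, so compatibility there is enough to
-- descend.
theorem factorsThrough_lowerChart {T : Type*} (r : A ⊕ {y : P × I // y.2 < 1} → T)
    (hr : ∀ x, r (Sum.inr ⟨(x, 0), zero_lt_one⟩) = r (Sum.inl (α x))) :
    Function.FactorsThrough r (lowerChart α β) := by
  -- Extending `r` by `none` at height `1` gives a function on the whole quotient, which avoids
  -- analysing the equivalence relation generated by the gluing.
  let R : HPushout α β → Option T :=
    Quot.lift (Sum.elim (Sum.elim (fun a => some (r (Sum.inl a))) fun _ => none)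
      fun y => if h : y.2 < 1 then some (r (Sum.inr ⟨y, h⟩)) else none) (by
        rintro _ _ (x | x)
        · simpa using hr x
        · simp)
  have hR : ∀ u, R (lowerChart α β u) = some (r u) := by
    rintro (a | ⟨y, hy⟩)
    · rfl
    · exact dif_pos hy
  intro u v huv
  have := hR u
  rw [huv, hR v] at this
  exact (Option.some_injective _ this).symm

end HPushout

/-! ### Joins and covers by two open sets -/

section Join

variable {K Y Z C : Type*} [TopologicalSpace K] [TopologicalSpace Y] [TopologicalSpace Z]
  [TopologicalSpace C] (f : C(Y, C)) (g : C(Z, C))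

/-- The height function of the join. -/
abbrev joinHeight : C(Join f g, I) := HPushout.height _ _

/-- A point `((y, z, θ), t)` with `t < 1` slides back along `θ` to `y`. The path `u ↦ θ (u * t)`
runs from `f y` to `θ t` and is constant for `t = 0`, so it agrees with the constant path on the
left end. -/
theorem isSectional_joinMap_lower : IsSectional (joinMap f g) f {z | joinHeight f g z < 1} := by
  refine hasHomotopyLift_iff.2 ?_
  let r : C(Y ⊕ {y : HPullback f g × I // y.2 < 1}, Y × C(I, C)) :=
    ⟨Sum.elim (fun a => (a, ContinuousMap.const I (f a)))
      fun y => (y.1.1.1.1, y.1.1.1.2.2.comp ⟨fun t => t * y.1.2, by fun_prop⟩), by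
      refine Continuous.sumElim ?_ ?_
      · exact continuous_id.prodMk (ContinuousMap.continuous_const'.comp f.continuous)
      · refine Continuous.prodMk (by fun_prop) ?_
        refine ContinuousMap.continuous_of_continuous_uncurry _ ?_
        have h : Continuous fun w : {y : HPullback f g × I // y.2 < 1} × I =>
            (w.1.1.1.1.2.2 : C(I, C)) := by fun_prop
        exact h.eval (by fun_prop : Continuous fun w : {y : HPullback f g × I // y.2 < 1} × I =>
          w.2 * w.1.1.2)⟩
  have hq : IsQuotientMap
      (⟨_, (HPushout.isQuotientMap_lowerChart (α := HPullback.fst f g)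
        (β := HPullback.snd f g)).continuous⟩ : C(_, _)) := HPushout.isQuotientMap_lowerChart
  have hr : Function.FactorsThrough r
      (HPushout.lowerChart (HPullback.fst f g) (HPullback.snd f g)) := by
    refine HPushout.factorsThrough_lowerChart r fun x => Prod.ext rfl ?_
    ext t
    change x.1.2.2 (t * 0) = f x.1.1
    rw [mul_zero, x.2.1]
  refine ⟨hq.lift r hr, fun z => ?_⟩
  obtain ⟨u, rfl⟩ := hq.surjective z
  rw [show hq.lift r hr _ = r u from DFunLike.congr_fun (hq.lift_comp r hr) u]
  rcases u with a | ⟨⟨x, t⟩, ht⟩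
  · exact ⟨rfl, rfl⟩
  · refine ⟨?_, ?_⟩
    · change x.1.2.2 (0 * t) = f x.1.1
      rw [zero_mul, x.2.1]
    · change x.1.2.2 (1 * t) = x.1.2.2 t
      rw [one_mul]

/-- Reversal of paths `E_{f,g} → E_{g,f}`. -/
def HPullback.swap : C(HPullback f g, HPullback g f) where
  toFun x := ⟨(x.1.2.1, x.1.1, x.1.2.2.comp ⟨σ, continuous_symm⟩),
    by simp [x.2.2], by simp [x.2.1]⟩
  continuous_toFun := by
    refine Continuous.subtype_mk (Continuous.prodMk ?_ (Continuous.prodMk ?_ ?_)) _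
    · exact (HPullback.snd f g).continuous
    · exact (HPullback.fst f g).continuous
    · exact (ContinuousMap.continuous_precomp _).comp
        (continuous_snd.comp (continuous_snd.comp continuous_subtype_val))

/-- The symmetry `Y *_C Z → Z *_C Y` of the join. -/
def joinSwap : C(Join f g, Join g f) where
  toFun := Quot.lift (Sum.elim (Sum.elim (HPushout.inr _ _) (HPushout.inl _ _))
    fun y => HPushout.cyl _ _ (HPullback.swap f g y.1, σ y.2)) (by
      rintro _ _ (x | x)
      · simp only [Sum.elim_inl, Sum.elim_inr, symm_zero, HPushout.cyl_one]
        rfl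
      · simp only [Sum.elim_inl, Sum.elim_inr, symm_one, HPushout.cyl_zero]
        rfl)
  continuous_toFun := by
    refine continuous_quot_lift _ ?_
    refine Continuous.sumElim (Continuous.sumElim ?_ ?_) ?_
    · exact (HPushout.inr _ _).continuous
    · exact (HPushout.inl _ _).continuous
    · exact (HPushout.cyl _ _).continuous.comp
        (((HPullback.swap f g).continuous.comp continuous_fst).prodMk
          (continuous_symm.comp continuous_snd))

theorem joinMap_joinSwap : (joinMap g f).comp (joinSwap f g) = joinMap f g := by
  ext z
  induction z using HPushout.ind with
  | left a => rfl
  | right b => rfl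
  | cyl y => exact congrArg y.1.1.2.2 (symm_symm y.2)

theorem joinHeight_joinSwap (z : Join f g) :
    joinHeight g f (joinSwap f g z) = σ (joinHeight f g z) := by
  induction z using HPushout.ind with
  | left a => exact symm_zero.symm
  | right b => exact symm_one.symm
  | cyl y => rfl

theorem isSectional_joinMap_upper : IsSectional (joinMap f g) g {z | 0 < joinHeight f g z} := by
  have h := (isSectional_joinMap_lower g f).preimage (joinSwap f g)
  rw [joinMap_joinSwap] at h
  refine h.mono fun z hz => ?_
  change joinHeight g f (joinSwap f g z) < 1
  rw [joinHeight_joinSwap]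
  exact (symm_lt_symm.2 hz).trans_eq symm_zero

variable {f g}

/-- A homotopy lift through a join yields an open cover by two sectional subsets. -/
theorem HasHomotopyLift.exists_open_cover_of_join {ψ : C(K, C)}
    (h : HasHomotopyLift (joinMap f g) ψ) :
    ∃ U V : Set K, IsOpen U ∧ IsOpen V ∧ IsSectional ψ f U ∧ IsSectional ψ g V ∧
      U ∪ V = univ := by
  obtain ⟨s, hs⟩ := h
  refine ⟨s ⁻¹' {z | joinHeight f g z < 1}, s ⁻¹' {z | 0 < joinHeight f g z}, ?_, ?_,
    ((isSectional_joinMap_lower f g).preimage s).of_homotopic hs,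
    ((isSectional_joinMap_upper f g).preimage s).of_homotopic hs, ?_⟩
  · exact (isOpen_lt (joinHeight f g).continuous continuous_const).preimage s.continuous
  · exact (isOpen_lt continuous_const (joinHeight f g).continuous).preimage s.continuous
  · refine eq_univ_of_forall fun x => ?_
    rcases lt_or_ge (joinHeight f g (s x)) 1 with h | h
    · exact Or.inl h
    · exact Or.inr (zero_lt_one.trans_le h)

/-- Concatenation of two families of paths with common endpoint, the second one reversed. -/
theorem exists_concat {W : Type*} [TopologicalSpace W] (h k : C(W, C(I, C)))
    (hk : ∀ x, h x 1 = k x 1) :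
    ∃ θ : C(W, C(I, C)), (∀ x (t : I), (t : ℝ) ≤ 1 / 2 →
        θ x t = h x (projIcc 0 1 zero_le_one (2 * t))) ∧
      ∀ x (t : I), 1 / 2 ≤ (t : ℝ) → θ x t = k x (projIcc 0 1 zero_le_one (2 - 2 * t)) := by
  have hmid : ∀ y : W × I, (y.2 : ℝ) = 1 / 2 → h y.1 (projIcc 0 1 zero_le_one (2 * (y.2 : ℝ))) =
      k y.1 (projIcc 0 1 zero_le_one (2 - 2 * (y.2 : ℝ))) := by
    intro y hy
    have h1 : (2 : ℝ) * y.2 = 1 := by linarith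
    have h2 : (2 : ℝ) - 2 * y.2 = 1 := by linarith
    rw [h2, h1, projIcc_right]
    exact hk y.1
  let F : C(W × I, C) := ⟨fun y => if (y.2 : ℝ) ≤ 1 / 2 then
      h y.1 (projIcc 0 1 zero_le_one (2 * (y.2 : ℝ)))
      else k y.1 (projIcc 0 1 zero_le_one (2 - 2 * (y.2 : ℝ))), by
    refine Continuous.if_le ?_ ?_ (by fun_prop) continuous_const hmid
    · exact (h.continuous.comp continuous_fst).eval (continuous_projIcc.comp (by fun_prop))
    · exact (k.continuous.comp continuous_fst).eval (continuous_projIcc.comp (by fun_prop))⟩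
  refine ⟨F.curry, fun x t ht => if_pos ht, fun x t ht => ?_⟩
  rcases ht.eq_or_lt with ht | ht
  · exact (if_pos ht.ge).trans (hmid (x, t) ht.symm)
  · exact if_neg ht.not_ge

/-- Gluing of three maps along an open cover whose outer members are disjoint. -/
theorem exists_glue_three {T : Type*} [TopologicalSpace T] {W₀ M W₁ : Set K} (hW₀ : IsOpen W₀)
    (hM : IsOpen M) (hW₁ : IsOpen W₁) (hcover : ∀ x, x ∈ W₀ ∨ x ∈ M ∨ x ∈ W₁)
    (hd : Disjoint W₀ W₁) (Γ₀ : C(W₀, T)) (Γ : C(M, T)) (Γ₁ : C(W₁, T))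
    (h₀ : ∀ x (h : x ∈ W₀) (h' : x ∈ M), Γ₀ ⟨x, h⟩ = Γ ⟨x, h'⟩)
    (h₁ : ∀ x (h : x ∈ W₁) (h' : x ∈ M), Γ₁ ⟨x, h⟩ = Γ ⟨x, h'⟩) :
    ∃ G : C(K, T), (∀ x : W₀, G x = Γ₀ x) ∧ (∀ x : M, G x = Γ x) ∧ ∀ x : W₁, G x = Γ₁ x := by
  let S : Fin 3 → Set K := ![W₀, M, W₁]
  let F : (i : Fin 3) → C(S i, T) := fun i =>
    match i with
    | 0 => Γ₀
    | 1 => Γ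
    | 2 => Γ₁
  have hF : ∀ i j x (hi : x ∈ S i) (hj : x ∈ S j), F i ⟨x, hi⟩ = F j ⟨x, hj⟩ := by
    intro i j x hi hj
    match i, j with
    | 0, 0 | 1, 1 | 2, 2 => rfl
    | 0, 1 => exact h₀ x hi hj
    | 1, 0 => exact (h₀ x hj hi).symm
    | 2, 1 => exact h₁ x hi hj
    | 1, 2 => exact (h₁ x hj hi).symm
    | 0, 2 => exact (disjoint_left.1 hd hi hj).elim
    | 2, 0 => exact (disjoint_left.1 hd hj hi).elim
  have hS : ∀ x, ∃ i, S i ∈ nhds x := fun x => by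
    rcases hcover x with h | h | h
    exacts [⟨0, hW₀.mem_nhds h⟩, ⟨1, hM.mem_nhds h⟩, ⟨2, hW₁.mem_nhds h⟩]
  have hG := fun i (x : S i) => ContinuousMap.liftCover_coe (hφ := hF) (hS := hS) x
  exact ⟨ContinuousMap.liftCover S F hF hS, hG 0, hG 1, hG 2⟩

/-- Over a normal space, a cover by two open sectional subsets yields a homotopy lift through the
join. -/
theorem hasHomotopyLift_join_of_open_cover [NormalSpace K] {ψ : C(K, C)} {U V : Set K}
    (hU : IsOpen U) (hV : IsOpen V) (hfU : IsSectional ψ f U) (hgV : IsSectional ψ g V)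
    (hUV : U ∪ V = univ) : HasHomotopyLift (joinMap f g) ψ := by
  obtain ⟨S, hS⟩ := hasHomotopyLift_iff.1 (show HasHomotopyLift f (ψ.restrict U) from hfU)
  obtain ⟨T, hT⟩ := hasHomotopyLift_iff.1 (show HasHomotopyLift g (ψ.restrict V) from hgV)
  obtain ⟨μ, hμ0, hμ1, -⟩ := exists_continuous_zero_one_of_isClosed hV.isClosed_compl
    hU.isClosed_compl (disjoint_left.2 fun x hx hx' =>
      (hUV.ge (mem_univ x)).elim hx' hx)
  have hμV : ∀ x, μ x ≠ 0 → x ∈ V := fun x hx => by_contra fun h => hx (hμ0 h)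
  have hμU : ∀ x, μ x ≠ 1 → x ∈ U := fun x hx => by_contra fun h => hx (hμ1 h)
  -- The thirds leave plateaus: `τ` below is constant on the open sets `W₀` and `W₁`, so the map
  -- through the cylinder agrees with the end lifts on open overlaps.
  let W₀ : Set K := {x | μ x < 1 / 3}
  let W₁ : Set K := {x | 2 / 3 < μ x}
  let M : Set K := {x | 0 < μ x ∧ μ x < 1}
  have hW₀ : W₀ ⊆ U := fun x hx => hμU x (ne_of_lt (lt_trans hx (by norm_num)))
  have hW₁ : W₁ ⊆ V := fun x hx => hμV x (ne_of_gt (lt_trans (by norm_num) hx))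
  have hMU : M ⊆ U := fun x hx => hμU x hx.2.ne
  have hMV : M ⊆ V := fun x hx => hμV x hx.1.ne'
  let τ : C(K, I) := ⟨fun x => projIcc 0 1 zero_le_one (3 * μ x - 1),
    continuous_projIcc.comp (by fun_prop)⟩
  have hτ0 : ∀ x ∈ W₀, τ x = 0 := fun x hx =>
    projIcc_of_le_left zero_le_one (by have : μ x < 1 / 3 := hx; linarith)
  have hτ1 : ∀ x ∈ W₁, τ x = 1 := fun x hx =>
    projIcc_of_right_le zero_le_one (by have : 2 / 3 < μ x := hx; linarith)
  let SM : C(M, Y × C(I, C)) := S.comp ⟨inclusion hMU, continuous_inclusion hMU⟩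
  let TM : C(M, Z × C(I, C)) := T.comp ⟨inclusion hMV, continuous_inclusion hMV⟩
  obtain ⟨θ, hθS, hθT⟩ := exists_concat (ContinuousMap.snd.comp SM) (ContinuousMap.snd.comp TM)
    (fun x => (hS ⟨x, hMU x.2⟩).2.trans (hT ⟨x, hMV x.2⟩).2.symm)
  have hθ0 : ∀ x, θ x 0 = f (SM x).1 := fun x => by
    rw [hθS x 0 (by norm_num)]
    rw [Icc.coe_zero, mul_zero, projIcc_left]
    exact (hS ⟨x, hMU x.2⟩).1
  have hθ1 : ∀ x, θ x 1 = g (TM x).1 := fun x => by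
    rw [hθT x 1 (by norm_num)]
    rw [Icc.coe_one, mul_one, sub_self, projIcc_left]
    exact (hT ⟨x, hMV x.2⟩).1
  let e : C(M, HPullback f g) := ⟨fun x => ⟨((SM x).1, (TM x).1, θ x), hθ0 x, hθ1 x⟩, by
    exact Continuous.subtype_mk (by fun_prop) _⟩
  -- `θ` passes through `ψ x` at time `1 / 2`. Moving linearly from `τ x` to `1 / 2` along `θ` is
  -- therefore a homotopy from the join map to `ψ`; for `τ x = 0` or `1` it is the given path of `S`
  -- or `T`.
  let c : C(M × I, I) := ⟨fun y => projIcc 0 1 zero_le_one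
    ((1 - (y.2 : ℝ)) * (τ y.1 : ℝ) + y.2 / 2), continuous_projIcc.comp (by fun_prop)⟩
  let Γ₀ : C(W₀, Join f g × C(I, C)) :=
    ((HPushout.inl _ _).prodMap (ContinuousMap.id _)).comp
      (S.comp ⟨inclusion hW₀, continuous_inclusion hW₀⟩)
  let Γ₁ : C(W₁, Join f g × C(I, C)) :=
    ((HPushout.inr _ _).prodMap (ContinuousMap.id _)).comp
      (T.comp ⟨inclusion hW₁, continuous_inclusion hW₁⟩)
  let N : C(M, C(I, C)) := ContinuousMap.curry ⟨fun y => θ y.1 (c y),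
    (θ.continuous.comp continuous_fst).eval c.continuous⟩
  let Γ : C(M, Join f g × C(I, C)) :=
    ((HPushout.cyl _ _).comp (e.prodMk (τ.comp ⟨Subtype.val, continuous_subtype_val⟩))).prodMk N
  have hM₀ : ∀ x (h : x ∈ W₀) (h' : x ∈ M), Γ₀ ⟨x, h⟩ = Γ ⟨x, h'⟩ := by
    intro x h h'
    refine Prod.ext ?_ (ContinuousMap.ext fun u => ?_)
    · change HPushout.inl _ _ (HPullback.fst f g (e ⟨x, h'⟩)) = HPushout.cyl _ _ (e ⟨x, h'⟩, τ x)
      rw [hτ0 x h, HPushout.cyl_zero]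
    · change (S ⟨x, hW₀ h⟩).2 u = θ ⟨x, h'⟩ (c (⟨x, h'⟩, u))
      have hu := u.2
      have hc : (c (⟨x, h'⟩, u) : ℝ) = u / 2 := by
        change (projIcc (0 : ℝ) 1 zero_le_one ((1 - (u : ℝ)) * (τ x : ℝ) + u / 2) : ℝ) = u / 2
        rw [hτ0 x h, Icc.coe_zero, mul_zero, zero_add, projIcc_of_mem _ ⟨by linarith [hu.1],
          by linarith [hu.2]⟩]
      rw [hθS _ _ (by rw [hc]; linarith [hu.2]), hc, mul_div_cancel₀ _ two_ne_zero, projIcc_val]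
      rfl
  have hM₁ : ∀ x (h : x ∈ W₁) (h' : x ∈ M), Γ₁ ⟨x, h⟩ = Γ ⟨x, h'⟩ := by
    intro x h h'
    refine Prod.ext ?_ (ContinuousMap.ext fun u => ?_)
    · change HPushout.inr _ _ (HPullback.snd f g (e ⟨x, h'⟩)) = HPushout.cyl _ _ (e ⟨x, h'⟩, τ x)
      rw [hτ1 x h, HPushout.cyl_one]
    · change (T ⟨x, hW₁ h⟩).2 u = θ ⟨x, h'⟩ (c (⟨x, h'⟩, u))
      have hu := u.2
      have hc : (c (⟨x, h'⟩, u) : ℝ) = 1 - u / 2 := by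
        change (projIcc (0 : ℝ) 1 zero_le_one ((1 - (u : ℝ)) * (τ x : ℝ) + u / 2) : ℝ) = 1 - u / 2
        rw [hτ1 x h, Icc.coe_one, show (1 - (u : ℝ)) * 1 + u / 2 = 1 - u / 2 by ring,
          projIcc_of_mem _ ⟨by linarith [hu.2], by linarith [hu.1]⟩]
      rw [hθT _ _ (by rw [hc]; linarith [hu.2]), hc,
        show 2 - 2 * (1 - (u : ℝ) / 2) = u by ring, projIcc_val]
      rfl
  have hcover : ∀ x, x ∈ W₀ ∨ x ∈ M ∨ x ∈ W₁ := by
    intro x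
    rcases lt_or_ge (μ x) (1 / 3) with h | h
    · exact Or.inl h
    rcases lt_or_ge (2 / 3) (μ x) with h' | h'
    · exact Or.inr (Or.inr h')
    · exact Or.inr (Or.inl ⟨by linarith, by linarith⟩)
  obtain ⟨G, hG₀, hG, hG₁⟩ := exists_glue_three (isOpen_lt μ.continuous continuous_const)
    ((isOpen_lt continuous_const μ.continuous).inter (isOpen_lt μ.continuous continuous_const))
    (isOpen_lt continuous_const μ.continuous) hcover
    (disjoint_left.2 fun x hx hx' => by
      have h : μ x < 1 / 3 := hx
      have h' : 2 / 3 < μ x := hx'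
      linarith) Γ₀ Γ Γ₁ hM₀ hM₁
  refine hasHomotopyLift_iff.2 ⟨G, fun x => ?_⟩
  rcases hcover x with h | h | h
  · rw [hG₀ ⟨x, h⟩]
    exact hS ⟨x, hW₀ h⟩
  · rw [hG ⟨x, h⟩]
    constructor
    · change θ ⟨x, h⟩ (c (⟨x, h⟩, 0)) = θ ⟨x, h⟩ (τ x)
      congr 1
      change projIcc (0 : ℝ) 1 zero_le_one ((1 - ((0 : I) : ℝ)) * (τ x : ℝ) + (0 : I) / 2) = τ x
      rw [Icc.coe_zero, sub_zero, one_mul, zero_div, add_zero, projIcc_val]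
    · change θ ⟨x, h⟩ (c (⟨x, h⟩, 1)) = ψ x
      have hc : (c (⟨x, h⟩, 1) : ℝ) = 1 / 2 := by
        change (projIcc (0 : ℝ) 1 zero_le_one ((1 - ((1 : I) : ℝ)) * (τ x : ℝ) + (1 : I) / 2) : ℝ) =
          1 / 2
        rw [Icc.coe_one, sub_self, zero_mul, zero_add, projIcc_of_mem _ ⟨by norm_num, by norm_num⟩]
      rw [hθS _ _ hc.le, hc, mul_div_cancel₀ _ two_ne_zero, projIcc_right]
      exact (hS ⟨x, hMU h⟩).2
  · rw [hG₁ ⟨x, h⟩]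
    exact hT ⟨x, hW₁ h⟩

end Join

/-! ### Covers by sectional subsets -/

section Cover

variable {A X : Type u} {K : Type v} [TopologicalSpace A] [TopologicalSpace X] [TopologicalSpace K]

/-- `K` is covered by open subsets `U i` over which the maps `ψ i` lift through `p` up to
homotopy. -/
def HasSectionalCover (p : C(A, X)) {n : ℕ} (ψ : Fin n → C(K, X)) : Prop :=
  ∃ U : Fin n → Set K, (∀ i, IsOpen (U i)) ∧ (∀ i, IsSectional (ψ i) p (U i)) ∧ ⋃ i, U i = univ

theorem hasSectionalCover_one_iff {p : C(A, X)} {ψ : Fin 1 → C(K, X)} :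
    HasSectionalCover p ψ ↔ HasHomotopyLift p (ψ 0) := by
  rw [← isSectional_univ_iff]
  constructor
  · rintro ⟨U, -, hU, hcover⟩
    refine (hU 0).mono fun x hx => ?_
    obtain ⟨i, hi⟩ := mem_iUnion.1 (hcover.ge hx)
    rwa [Subsingleton.elim i 0] at hi
  · intro h
    refine ⟨fun _ => univ, fun _ => isOpen_univ, fun i => ?_, iUnion_const _⟩
    rwa [Subsingleton.elim i 0]

theorem HasSectionalCover.snoc {p : C(A, X)} {n : ℕ} {ψ : Fin (n + 1) → C(K, X)} {U V : Set K}
    (hU : IsOpen U) (hV : IsOpen V) (hUV : U ∪ V = univ)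
    (h : HasSectionalCover p fun i : Fin n => (ψ i.castSucc).restrict U)
    (hpV : IsSectional (ψ (Fin.last n)) p V) : HasSectionalCover p ψ := by
  obtain ⟨W, hW, hpW, hcover⟩ := h
  refine ⟨Fin.snoc (α := fun _ => Set K) (fun i => Subtype.val '' W i) V, fun i => ?_, fun i => ?_,
    eq_univ_of_forall fun x => mem_iUnion.2 ?_⟩
  · refine Fin.lastCases ?_ (fun i => ?_) i
    · rwa [Fin.snoc_last]
    · rw [Fin.snoc_castSucc]
      exact hU.isOpenMap_subtype_val _ (hW i)
  · refine Fin.lastCases ?_ (fun i => ?_) i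
    · rwa [Fin.snoc_last]
    · rw [Fin.snoc_castSucc]
      exact (hpW i).image_val
  · by_cases hx : x ∈ U
    · obtain ⟨i, hi⟩ := mem_iUnion.1 (hcover.ge (mem_univ (⟨x, hx⟩ : U)))
      exact ⟨i.castSucc, by rw [Fin.snoc_castSucc]; exact ⟨_, hi, rfl⟩⟩
    · exact ⟨Fin.last n, by
        rw [Fin.snoc_last]; exact (hUV.ge (mem_univ x)).resolve_left hx⟩

/-- Normality places an open `U` between the complement of the last member and the union of the
others, with closure still inside that union. The closure `F` is again normal, and the remaining
members restrict to a cover of it. -/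
theorem HasSectionalCover.exists_closed [NormalSpace K] {p : C(A, X)} {n : ℕ}
    {ψ : Fin (n + 1) → C(K, X)} (h : HasSectionalCover p ψ) :
    ∃ F U V : Set K, IsClosed F ∧ IsOpen U ∧ IsOpen V ∧ U ⊆ F ∧ U ∪ V = univ ∧
      (HasSectionalCover p fun i : Fin n => (ψ i.castSucc).restrict F) ∧
      IsSectional (ψ (Fin.last n)) p V := by
  obtain ⟨W, hW, hpW, hcover⟩ := h
  have hcover' : ∀ x, (∃ i : Fin n, x ∈ W i.castSucc) ∨ x ∈ W (Fin.last n) := fun x => by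
    obtain ⟨i, hi⟩ := mem_iUnion.1 (hcover.ge (mem_univ x))
    induction i using Fin.lastCases with
    | last => exact Or.inr hi
    | cast i => exact Or.inl ⟨i, hi⟩
  obtain ⟨U, hU, hWU, hUF⟩ := normal_exists_closure_subset (hW (Fin.last n)).isClosed_compl
    (isOpen_iUnion fun i : Fin n => hW i.castSucc)
    fun x hx => mem_iUnion.2 ((hcover' x).resolve_right hx)
  refine ⟨closure U, U, W (Fin.last n), isClosed_closure, hU, hW _, subset_closure, ?_, ?_, hpW _⟩
  · exact eq_univ_of_forall fun x => or_iff_not_imp_right.2 fun hx => hWU hx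
  · refine ⟨fun i => Subtype.val ⁻¹' W i.castSucc,
      fun i => (hW _).preimage continuous_subtype_val, fun i => ?_, ?_⟩
    · exact (hpW i.castSucc).preimage ⟨Subtype.val, continuous_subtype_val⟩
    · refine eq_univ_of_forall fun x => mem_iUnion.2 ?_
      simpa using hUF x.2

theorem relSecat_le_iff {p : C(A, X)} {φ : C(K, X)} {n : ℕ} :
    relSecat φ p ≤ n ↔ HasSectionalCover p fun _ : Fin (n + 1) => φ := by
  constructor
  · intro h
    have hne : {m : ℕ∞ | ∃ n : ℕ, m = n ∧ ∃ U : Fin (n + 1) → Set K,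
        (∀ i, IsOpen (U i)) ∧ (∀ i, IsSectional φ p (U i)) ∧ ⋃ i, U i = univ}.Nonempty := by
      rw [nonempty_iff_ne_empty]
      -- The infimum of the empty set is `⊤`, which is not bounded by a natural number.
      intro he
      rw [relSecat, he, sInf_empty] at h
      exact ENat.natCast_ne_top n (top_le_iff.1 h)
    obtain ⟨m, hm, U, hU, hpU, hcover⟩ := csInf_mem hne
    have hmn : m ≤ n := by
      rw [← Nat.cast_le (α := ℕ∞), ← hm]
      exact h
    -- A cover with `m + 1 ≤ n + 1` members is padded by repeating its last member.
    refine ⟨fun i => U ⟨min i m, by omega⟩, fun i => hU _, fun i => hpU _,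
      eq_univ_of_forall fun x => mem_iUnion.2 ?_⟩
    obtain ⟨i, hi⟩ := mem_iUnion.1 (hcover.ge (mem_univ x))
    refine ⟨⟨i, by omega⟩, ?_⟩
    convert hi using 2
    exact Fin.ext (min_eq_left (Nat.lt_succ_iff.1 i.2))
  · rintro ⟨U, hU⟩
    exact sInf_le ⟨n, rfl, U, hU⟩

/-! ### Iterated joins -/

theorem HasHomotopyLift.hasSectionalCover_of_iterJoin {p : C(A, X)} {n : ℕ} {φ : C(K, X)}
    (h : HasHomotopyLift (iterJoinMap p n) φ) : HasSectionalCover p fun _ : Fin (n + 1) => φ := by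
  induction n generalizing K with
  | zero => exact hasSectionalCover_one_iff.2 h
  | succ n ih =>
    obtain ⟨U, V, hU, hV, hfU, hpV, hUV⟩ := HasHomotopyLift.exists_open_cover_of_join h
    exact .snoc hU hV hUV (ih (φ := φ.restrict U) hfU) hpV

theorem HasSectionalCover.hasHomotopyLift_iterJoin [NormalSpace K] {p : C(A, X)} {n : ℕ}
    {φ : C(K, X)} (h : HasSectionalCover p fun _ : Fin (n + 1) => φ) :
    HasHomotopyLift (iterJoinMap p n) φ := by
  induction n generalizing K with
  | zero => exact hasSectionalCover_one_iff.1 h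
  | succ n ih =>
    obtain ⟨F, U, V, hF, hU, hV, hUF, hUV, hpF, hpV⟩ := h.exists_closed
    -- Closed subspaces inherit normality, so the induction hypothesis applies to `F`; the lift is
    -- then restricted to the open set `U ⊆ F`.
    have := hF.isClosedEmbedding_subtypeVal.normalSpace
    have hfF : IsSectional φ (iterJoinMap p n) F := ih (φ := φ.restrict F) hpF
    exact hasHomotopyLift_join_of_open_cover hU hV (hfF.mono hUF) hpV hUV

/-! ### Sectional fat wedges -/

/-- The homeomorphism `X^n × X ≃ X^{n+1}`. -/
def snocHomeomorph (X : Type*) [TopologicalSpace X] (n : ℕ) :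
    (Fin n → X) × X ≃ₜ (Fin (n + 1) → X) where
  toFun := snocMap X n
  invFun y := (Fin.init (α := fun _ => X) y, y (Fin.last n))
  left_inv y := Prod.ext (Fin.init_snoc (α := fun _ => X) _ _) (Fin.snoc_last (α := fun _ => X) _ _)
  right_inv y := Fin.snoc_init_self (α := fun _ => X) y
  continuous_toFun := (snocMap X n).continuous
  continuous_invFun := by
    refine Continuous.prodMk (continuous_pi fun i => ?_) (continuous_apply _)
    exact continuous_apply i.castSucc

theorem pi_eq_snocMap_comp {n : ℕ} (ψ : Fin (n + 1) → C(K, X)) :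
    ContinuousMap.pi ψ = (snocMap X n).comp
      ((ContinuousMap.pi fun i : Fin n => ψ i.castSucc).prodMk (ψ (Fin.last n))) := by
  ext x i
  refine Fin.lastCases ?_ (fun i => ?_) i
  · exact (Fin.snoc_last (α := fun _ => X) _ _).symm
  · exact (Fin.snoc_castSucc (α := fun _ => X) (ψ (Fin.last n) x)
      (fun i : Fin n => ψ i.castSucc x) i).symm

theorem hasHomotopyLift_comp_homeomorph {Y C D : Type*} [TopologicalSpace Y] [TopologicalSpace C]
    [TopologicalSpace D] {ψ : C(K, C)} (e : C ≃ₜ D) {f : C(Y, C)} :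
    HasHomotopyLift ((e : C(C, D)).comp f) ((e : C(C, D)).comp ψ) ↔ HasHomotopyLift f ψ := by
  refine ⟨fun h => ?_, fun h => h.postcomp (e : C(C, D))⟩
  have := h.postcomp (e.symm : C(D, C))
  convert this using 1 <;> ext <;> simp

theorem hasHomotopyLift_fatWedgeMap_zero {p : C(A, X)} {ψ : Fin 1 → C(K, X)} :
    HasHomotopyLift (fatWedgeMap p 0) (ContinuousMap.pi ψ) ↔ HasHomotopyLift p (ψ 0) := by
  let e : X ≃ₜ (Fin 1 → X) := (Homeomorph.funUnique (Fin 1) X).symm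
  have he : ContinuousMap.pi ψ = (e : C(X, Fin 1 → X)).comp (ψ 0) := by
    ext x i
    rw [Subsingleton.elim i 0]
    rfl
  rw [he]
  exact hasHomotopyLift_comp_homeomorph e

theorem hasHomotopyLift_fatWedgeMap_succ {p : C(A, X)} {n : ℕ} {ψ : Fin (n + 2) → C(K, X)} :
    HasHomotopyLift (fatWedgeMap p (n + 1)) (ContinuousMap.pi ψ) ↔
      HasHomotopyLift (joinMap ((fatWedgeMap p n).prodMap (ContinuousMap.id X))
        ((ContinuousMap.id (Fin (n + 1) → X)).prodMap p))
        ((ContinuousMap.pi fun i : Fin (n + 1) => ψ i.castSucc).prodMk (ψ (Fin.last (n + 1)))) := by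
  rw [pi_eq_snocMap_comp]
  exact hasHomotopyLift_comp_homeomorph (snocHomeomorph X (n + 1))

theorem HasHomotopyLift.hasSectionalCover_of_fatWedge {p : C(A, X)} {n : ℕ}
    {ψ : Fin (n + 1) → C(K, X)} (h : HasHomotopyLift (fatWedgeMap p n) (ContinuousMap.pi ψ)) :
    HasSectionalCover p ψ := by
  induction n generalizing K with
  | zero => exact hasSectionalCover_one_iff.2 (hasHomotopyLift_fatWedgeMap_zero.1 h)
  | succ n ih =>
    obtain ⟨U, V, hU, hV, hfU, hpV, hUV⟩ :=
      (hasHomotopyLift_fatWedgeMap_succ.1 h).exists_open_cover_of_join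
    refine .snoc hU hV hUV (ih (ψ := fun i => (ψ i.castSucc).restrict U) ?_) ?_
    · exact isSectional_prodMap_id_right.1 hfU
    · exact isSectional_prodMap_id_left.1 hpV

theorem HasSectionalCover.hasHomotopyLift_fatWedge [NormalSpace K] {p : C(A, X)} {n : ℕ}
    {ψ : Fin (n + 1) → C(K, X)} (h : HasSectionalCover p ψ) :
    HasHomotopyLift (fatWedgeMap p n) (ContinuousMap.pi ψ) := by
  induction n generalizing K with
  | zero => exact hasHomotopyLift_fatWedgeMap_zero.2 (hasSectionalCover_one_iff.1 h)
  | succ n ih =>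
    obtain ⟨F, U, V, hF, hU, hV, hUF, hUV, hpF, hpV⟩ := h.exists_closed
    have := hF.isClosedEmbedding_subtypeVal.normalSpace
    have hfF : IsSectional (ContinuousMap.pi fun i : Fin (n + 1) => ψ i.castSucc)
      (fatWedgeMap p n) F := ih hpF
    refine hasHomotopyLift_fatWedgeMap_succ.2
      (hasHomotopyLift_join_of_open_cover hU hV ?_ ?_ hUV)
    · exact isSectional_prodMap_id_right.2 (hfF.mono hUF)
    · exact isSectional_prodMap_id_left.2 hpV

end Cover

end RelSecat

theorem mainTheorem2 {A X : Type u} {K : Type v} [TopologicalSpace A] [TopologicalSpace X]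
    [TopologicalSpace K] [NormalSpace K] (p : C(A, X)) (φ : C(K, X)) (n : ℕ) :
    List.TFAE [
      RelSecat.relSecat φ p ≤ n,
      ∃ σ : C(K, RelSecat.IterJoin p n), ((RelSecat.iterJoinMap p n).comp σ).Homotopic φ,
      ∃ σ : C(K, RelSecat.FatWedge p n),
        ((RelSecat.fatWedgeMap p n).comp σ).Homotopic ((RelSecat.diag X (n + 1)).comp φ)] := by
  rw [RelSecat.relSecat_le_iff]
  tfae_have 1 → 2 := RelSecat.HasSectionalCover.hasHomotopyLift_iterJoin
  tfae_have 2 → 1 := RelSecat.HasHomotopyLift.hasSectionalCover_of_iterJoin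
  -- For the constant family `φ`, `ContinuousMap.pi` is definitionally the diagonal composed with
  -- `φ`.
  tfae_have 1 → 3 := RelSecat.HasSectionalCover.hasHomotopyLift_fatWedge
  tfae_have 3 → 1 := RelSecat.HasHomotopyLift.hasSectionalCover_of_fatWedge
  tfae_finish
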